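/- Let $G=(V,E)$ be a finite, simple, connected graph with graph distance $d$, vertex degrees $\operatorname{Deg}(x)=|\{y: y\sim x\}|$ and Laplacian $\Delta f(x)=\sum_{y\sim x}(f(y)-f(x))$ for $f\in\mathbb{R}^V$. Define $\Gamma_i:\mathbb{R}^V\times\mathbb{R}^V\to\mathbb{R}^V$ by $\Gamma_0(f,g)=fg$ and \[ 2\Gamma_{i+1}(f,g)=\Delta\Gamma_i(f,g)-\Gamma_i(f,\Delta g)-\Gamma_i(\Delta f,g), \] and let the Bakry–Émery curvature of a vertex $x$ be \[ K(x)=\inf\{\Gamma_2(f,f)(x) : f\in\mathbb{R}^V,\ \Gamma_1(f,f)(x)=1\}\in[-\infty,\infty]\qquad(\inf\emptyset=+\infty). \] Let $K>0$ be a real number such that $K(x)\ge K$ for all $x\in V$, and suppose that the effective diameter satisfies \[ \operatorname{diam}_{\operatorname{eff}}(G):=\frac1{|V|^2}\sum_{x,y\in V}d(x,y)=\frac{\max_{x\in V}\operatorname{Deg}(x)}{K}. \] Then $G$ is a hypercube, i.e. there is an integer $n\ge 0$ such that $G$ is isomorphic to the graph on $\{0,1\}^n$ in which two vertices are adjacent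 if and only if they differ in exactly one coordinate. -/

import Mathlib

namespace SimpleGraph

/-- The (non-normalized) graph Laplacian `Δ f (x) = ∑_{y ∼ x} (f y - f x)`. -/
noncomputable def laplacian {V : Type*} [Fintype V] (G : SimpleGraph V) [DecidableRel G.Adj]
    (f : V → ℝ) : V → ℝ :=
  fun x => ∑ y ∈ G.neighborFinset x, (f y - f x)

/-- The iterated carré du champ operators: `Γ₀(f, g) = f g` and
`2 Γᵢ₊₁(f, g) = Δ Γᵢ(f, g) - Γᵢ(f, Δ g) - Γᵢ(Δ f, g)`. -/
noncomputable def gammaOp {V : Type*} [Fintype V] (G : SimpleGraph V) [DecidableRel G.Adj] :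
    ℕ → (V → ℝ) → (V → ℝ) → V → ℝ
  | 0, f, g => fun x => f x * g x
  | i + 1, f, g => fun x =>
      (G.laplacian (gammaOp G i f g) x - gammaOp G i f (G.laplacian g) x
        - gammaOp G i (G.laplacian f) g x) / 2

/-- The Bakry–Émery curvature `K(x) = inf {Γ₂ f (x) : Γ f (x) = 1}` of a vertex, as an infimum in
the extended reals (so it is `+∞` at a vertex without neighbours, where the set is empty). -/
noncomputable def bakryEmeryCurvature {V : Type*} [Fintype V] (G : SimpleGraph V)
    [DecidableRel G.Adj] (x : V) : EReal :=
  ⨅ (f : V → ℝ) (_ : G.gammaOp 1 f f x = 1), ((G.gammaOp 2 f f x : ℝ) : EReal)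

/-- The effective diameter: the average of the graph distance over all ordered pairs of vertices
(including the pairs on the diagonal). -/
noncomputable def effectiveDiam {V : Type*} [Fintype V] (G : SimpleGraph V) : ℝ :=
  1 / (Fintype.card V : ℝ) ^ 2 * ∑ x : V, ∑ y : V, (G.dist x y : ℝ)

/-- The `n`-dimensional hypercube: the vertices are the binary strings of length `n`, and two of
them are adjacent iff they differ in exactly one coordinate. -/
def hypercube (n : ℕ) : SimpleGraph (Fin n → Bool) where
  Adj a b := hammingDist a b = 1
  symm := ⟨fun a b h => by rwa [hammingDist_comm]⟩
  loopless := ⟨fun a h => by simp at h⟩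

end SimpleGraph

namespace SimpleGraph

open Finset

/-! Write D for the maximal degree. For a 1-Lipschitz f with mean c, solve Δg = c - f. The curvature
bound for g and the maximum principle for Γ(g) give K²Γ(g) ≤ D/2, and Cauchy–Schwarz turns this into
c - f ≤ D/K. With f = d(x,·), evaluated at x, every mean distance is at most D/K, so the hypothesis
forces equality at every x.

In the equality case Γ(g) is constant and f - Kg is constant (`Connected.rigidity_of_sub_eq`). Hence
G is D-regular, d(x,·) changes by exactly 1 along each edge, and Δd(x,·) = D - K d(x,·).

Fix o and send y to the set of neighbours of o closer to y than o is. The Laplace equation at o says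
that this set has K d(y,o)/2 elements, which makes the map a homomorphism to the D-cube. It is
injective because `Connected.eq_zero_of_laplacian_eq_neg_mul` recovers d(y,·) from its values on the
unit ball at o; regularity then gives an isomorphism. -/

theorem Connected.eq_of_forall_adj {V : Type*} {G : SimpleGraph V} (hG : G.Connected) {u : V → ℝ}
    (hu : ∀ x y, G.Adj x y → u y = u x) (x y : V) : u x = u y := by
  obtain ⟨p⟩ := hG.preconnected x y
  induction p with
  | nil => rfl
  | cons hab _ ih => exact (hu _ _ hab).symm.trans ih

theorem Connected.abs_dist_sub_dist_le_one {V : Type*} {G : SimpleGraph V} (hG : G.Connected)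
    (x : V) {y z : V}
    (h : G.Adj y z) : |(G.dist x z : ℝ) - G.dist x y| ≤ 1 := by
  have h1 : G.dist x z ≤ G.dist x y + 1 := by
    simpa [SimpleGraph.dist_eq_one_iff_adj.mpr h] using hG.dist_triangle (u := x) (v := y) (w := z)
  have h2 : G.dist x y ≤ G.dist x z + 1 := by
    simpa [SimpleGraph.dist_eq_one_iff_adj.mpr h.symm] using
      hG.dist_triangle (u := x) (v := z) (w := y)
  have h1' : (G.dist x z : ℝ) ≤ G.dist x y + 1 := mod_cast h1
  have h2' : (G.dist x y : ℝ) ≤ G.dist x z + 1 := mod_cast h2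
  rw [abs_le]
  constructor <;> linarith

/-! ### Γ-calculus and the curvature-dimension inequality -/

section Operators

variable {V : Type*} [Fintype V] (G : SimpleGraph V) [DecidableRel G.Adj]

theorem gammaOp_one_apply (f g : V → ℝ) (x : V) :
    G.gammaOp 1 f g x = (∑ y ∈ G.neighborFinset x, (f y - f x) * (g y - g x)) / 2 := by
  simp only [gammaOp, laplacian]
  rw [Finset.mul_sum, Finset.sum_mul, ← Finset.sum_sub_distrib, ← Finset.sum_sub_distrib]
  congr 1
  exact Finset.sum_congr rfl fun y _ => by ring

theorem gammaOp_one_self_nonneg (f : V → ℝ) (x : V) : 0 ≤ G.gammaOp 1 f f x := by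
  rw [gammaOp_one_apply]
  exact div_nonneg (Finset.sum_nonneg fun y _ => mul_self_nonneg _) zero_le_two

theorem eq_of_gammaOp_one_self_nonpos {f : V → ℝ} {x : V} (h : G.gammaOp 1 f f x ≤ 0) {y : V}
    (hxy : G.Adj x y) : f y = f x := by
  have h0 := le_antisymm h (G.gammaOp_one_self_nonneg f x)
  rw [gammaOp_one_apply, div_eq_zero_iff, or_iff_left two_ne_zero,
    Finset.sum_eq_zero_iff_of_nonneg fun y _ => mul_self_nonneg _] at h0
  have := h0 y (by simpa using hxy)
  linarith [mul_self_eq_zero.mp this]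

theorem gammaOp_two_self (f : V → ℝ) (x : V) :
    G.gammaOp 2 f f x =
      G.laplacian (G.gammaOp 1 f f) x / 2 - G.gammaOp 1 f (G.laplacian f) x := by
  have hs : G.gammaOp 1 (G.laplacian f) f x = G.gammaOp 1 f (G.laplacian f) x := by
    simp only [gammaOp_one_apply, mul_comm]
  have : G.gammaOp 2 f f x = (G.laplacian (G.gammaOp 1 f f) x
    - G.gammaOp 1 f (G.laplacian f) x - G.gammaOp 1 (G.laplacian f) f x) / 2 := rfl
  rw [this, hs]
  ring

theorem laplacian_smul (a : ℝ) (f : V → ℝ) : G.laplacian (a • f) = a • G.laplacian f := by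
  ext x
  simp only [laplacian, Pi.smul_apply, smul_eq_mul, Finset.mul_sum, mul_sub]

theorem gammaOp_smul (i : ℕ) (a b : ℝ) (f g : V → ℝ) :
    G.gammaOp i (a • f) (b • g) = (a * b) • G.gammaOp i f g := by
  induction i generalizing f g with
  | zero =>
    ext x
    simp only [gammaOp, Pi.smul_apply, smul_eq_mul]
    ring
  | succ i ih =>
    ext x
    simp only [gammaOp, laplacian_smul, ih, Pi.smul_apply, smul_eq_mul]
    ring

/-- A lower bound on the Bakry–Émery curvature is the curvature-dimension condition
`CD(K, ∞)`. -/
theorem mul_gammaOp_one_le_gammaOp_two {K : ℝ} {x : V}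
    (hK : (K : EReal) ≤ G.bakryEmeryCurvature x) (f : V → ℝ) :
    K * G.gammaOp 1 f f x ≤ G.gammaOp 2 f f x := by
  rcases (G.gammaOp_one_self_nonneg f x).eq_or_lt with h0 | hpos
  -- The infimum says nothing when Γ(f)(x) = 0; but then f is constant around x and x minimises
  -- Γ(f), so Γ₂(f)(x) ≥ 0.
  · rw [← h0, mul_zero, gammaOp_two_self]
    have h1 : G.gammaOp 1 f (G.laplacian f) x = 0 := by
      rw [gammaOp_one_apply, Finset.sum_eq_zero, zero_div]
      intro y hy
      rw [G.eq_of_gammaOp_one_self_nonpos h0.symm.le (by simpa using hy)]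
      ring
    have h2 : 0 ≤ G.laplacian (G.gammaOp 1 f f) x :=
      Finset.sum_nonneg fun y _ => by
        rw [← h0, sub_zero]
        exact G.gammaOp_one_self_nonneg f y
    linarith
  · set c := G.gammaOp 1 f f x with hc
    have hs : (√c)⁻¹ * (√c)⁻¹ = c⁻¹ := by
      rw [← mul_inv, Real.mul_self_sqrt hpos.le]
    have h1 : G.gammaOp 1 ((√c)⁻¹ • f) ((√c)⁻¹ • f) x = 1 := by
      rw [gammaOp_smul, Pi.smul_apply, smul_eq_mul, hs, ← hc, inv_mul_cancel₀ hpos.ne']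
    have h2 := hK.trans (iInf₂_le ((√c)⁻¹ • f) h1)
    rw [EReal.coe_le_coe_iff, gammaOp_smul, Pi.smul_apply, smul_eq_mul, hs,
      inv_mul_eq_div, le_div_iff₀ hpos] at h2
    exact h2

theorem sum_laplacian (f : V → ℝ) : ∑ x, G.laplacian f x = 0 := by
  classical
  have h : ∀ x, G.laplacian f x = ∑ y, if G.Adj x y then f y - f x else 0 := by
    intro x
    rw [laplacian, ← Finset.sum_filter]
    congr 1
    ext y
    simp
  have h2 : ∑ x, G.laplacian f x = -∑ x, G.laplacian f x := by
    simp only [h]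
    conv_lhs => rw [Finset.sum_comm]
    simp only [← Finset.sum_neg_distrib]
    refine Finset.sum_congr rfl fun x _ => Finset.sum_congr rfl fun y _ => ?_
    simp only [G.adj_comm y x]
    split_ifs <;> ring
  linarith

/-! ### Maximum principle and the Poisson equation -/

variable {G}

/-- The strong maximum principle. -/
theorem Connected.eq_of_laplacian_nonneg (hG : G.Connected) {u : V → ℝ} {M : ℝ}
    (hle : ∀ x, u x ≤ M) {x₀ : V} (h₀ : u x₀ = M) (hu : ∀ x, u x = M → 0 ≤ G.laplacian u x)
    (x : V) : u x = M := by
  have step : ∀ a b, G.Adj a b → u a = M → u b = M := by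
    intro a b hab ha
    have hnp : ∀ y ∈ G.neighborFinset a, u y - u a ≤ 0 := fun y _ => by linarith [hle y]
    have h0 := le_antisymm (Finset.sum_nonpos hnp) (hu a ha)
    have := (Finset.sum_eq_zero_iff_of_nonpos hnp).mp h0 b (by simpa using hab)
    linarith
  obtain ⟨p⟩ := hG.preconnected x₀ x
  induction p with
  | nil => exact h₀
  | cons hab _ ih => exact ih (step _ _ hab h₀)

theorem Connected.exists_laplacian_eq (hG : G.Connected) {r : V → ℝ} (hr : ∑ x, r x = 0) :
    ∃ g, G.laplacian g = r := by
  have : Nonempty V := hG.nonempty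
  have hcard : (Fintype.card V : ℝ) ≠ 0 := Nat.cast_ne_zero.mpr Fintype.card_ne_zero
  -- The rank-one term removes the constants from the kernel of Δ, so T is bijective; summing T g =
  -- r shows that g has sum 0.
  let T : (V → ℝ) →ₗ[ℝ] (V → ℝ) :=
    { toFun := fun f x => G.laplacian f x + ∑ y, f y
      map_add' := fun f g => by
        ext x
        simp only [laplacian, Pi.add_apply, Finset.sum_add_distrib, add_sub_add_comm]
        ring
      map_smul' := fun a f => by
        ext x
        simp only [laplacian_smul, Pi.smul_apply, smul_eq_mul, RingHom.id_apply, mul_add,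
          Finset.mul_sum] }
  have hT : ∀ f x, T f x = G.laplacian f x + ∑ y, f y := fun _ _ => rfl
  have hsum : ∀ f, ∑ x, T f x = Fintype.card V * ∑ y, f y := by
    intro f
    simp only [hT, Finset.sum_add_distrib, sum_laplacian, zero_add, Finset.sum_const,
      Finset.card_univ, nsmul_eq_mul]
  have hinj : Function.Injective T := by
    rw [← LinearMap.ker_eq_bot, LinearMap.ker_eq_bot']
    intro f hf
    have h1 : ∑ y, f y = 0 := by
      have := hsum f
      rw [hf] at this
      simpa [hcard] using this
    have h2 : ∀ x, G.laplacian f x = 0 := by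
      intro x
      have := hT f x
      rw [hf, h1] at this
      simpa using this.symm
    obtain ⟨m, hm⟩ := Finite.exists_max f
    have h3 := hG.eq_of_laplacian_nonneg hm rfl fun x _ => (h2 x).ge
    simp only [h3, Finset.sum_const, Finset.card_univ, nsmul_eq_mul, mul_eq_zero, hcard,
      false_or] at h1
    ext x
    rw [h3 x, h1, Pi.zero_apply]
  obtain ⟨g, hg⟩ := LinearMap.injective_iff_surjective.mp hinj r
  have h1 : ∑ y, g y = 0 := by
    have := hsum g
    rw [hg, hr] at this
    simpa [hcard] using this.symm
  refine ⟨g, ?_⟩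
  ext x
  have := hT g x
  rw [hg, h1, add_zero] at this
  exact this.symm

/-! ### Gradient estimate, mean estimate and rigidity -/

/-- A `1`-Lipschitz function `f` and a multiple of a solution of `Δ g = c - f` are compared
through the curvature-dimension condition. -/
theorem gammaOp_one_sub_smul_le {K : ℝ} (hK : 0 < K) {x : V}
    (hcurv : (K : EReal) ≤ G.bakryEmeryCurvature x) {f g : V → ℝ} {c : ℝ}
    (hf : ∀ y, G.Adj x y → |f y - f x| ≤ 1) (hg : ∀ y, G.laplacian g y = c - f y) :
    G.gammaOp 1 (f - K • g) (f - K • g) x ≤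
      G.maxDegree / 2 - K ^ 2 * G.gammaOp 1 g g x + K * G.laplacian (G.gammaOp 1 g g) x := by
  have hff : G.gammaOp 1 f f x ≤ G.maxDegree / 2 := by
    rw [gammaOp_one_apply]
    gcongr
    calc ∑ y ∈ G.neighborFinset x, (f y - f x) * (f y - f x)
        ≤ ∑ y ∈ G.neighborFinset x, (1 : ℝ) := by
          refine Finset.sum_le_sum fun y hy => ?_
          have := hf y (by simpa using hy)
          rw [← abs_mul_abs_self]
          nlinarith [abs_nonneg (f y - f x)]
      _ = G.degree x := by simp
      _ ≤ G.maxDegree := mod_cast G.degree_le_maxDegree x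
  have hgl : G.gammaOp 1 g (G.laplacian g) x = -G.gammaOp 1 f g x := by
    simp only [gammaOp_one_apply, hg]
    rw [← neg_div, ← Finset.sum_neg_distrib]
    congr 1
    exact Finset.sum_congr rfl fun y _ => by ring
  have hexp : G.gammaOp 1 (f - K • g) (f - K • g) x =
      G.gammaOp 1 f f x - 2 * K * G.gammaOp 1 f g x + K ^ 2 * G.gammaOp 1 g g x := by
    simp only [gammaOp_one_apply, mul_div_assoc', Finset.mul_sum]
    rw [← sub_div, ← add_div, ← Finset.sum_sub_distrib, ← Finset.sum_add_distrib]
    congr 1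
    refine Finset.sum_congr rfl fun y _ => ?_
    simp only [Pi.sub_apply, Pi.smul_apply, smul_eq_mul]
    ring
  have hcd := G.mul_gammaOp_one_le_gammaOp_two hcurv g
  rw [gammaOp_two_self, hgl] at hcd
  have := mul_le_mul_of_nonneg_left hcd hK.le
  rw [hexp]
  linarith

theorem laplacian_sq_le (g : V → ℝ) (x : V) :
    G.laplacian g x ^ 2 ≤ 2 * G.maxDegree * G.gammaOp 1 g g x := by
  have h := sq_sum_le_card_mul_sum_sq (s := G.neighborFinset x) (f := fun y => g y - g x)
  have h1 : ∑ y ∈ G.neighborFinset x, (g y - g x) ^ 2 = 2 * G.gammaOp 1 g g x := by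
    rw [gammaOp_one_apply, mul_div_cancel₀ _ two_ne_zero]
    exact Finset.sum_congr rfl fun y _ => by ring
  rw [h1, card_neighborFinset_eq_degree] at h
  have h2 : (G.degree x : ℝ) ≤ G.maxDegree := mod_cast G.degree_le_maxDegree x
  calc G.laplacian g x ^ 2 ≤ G.degree x * (2 * G.gammaOp 1 g g x) := h
    _ ≤ G.maxDegree * (2 * G.gammaOp 1 g g x) := by
      have := G.gammaOp_one_self_nonneg g x
      gcongr
    _ = _ := by ring

/-- At a maximum of Γ(g) its Laplacian is nonpositive, and Γ(f - Kg) ≥ 0. -/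
theorem Connected.sq_mul_gammaOp_one_le (hG : G.Connected) {K : ℝ} (hK : 0 < K)
    (hcurv : ∀ x, (K : EReal) ≤ G.bakryEmeryCurvature x) {f g : V → ℝ} {c : ℝ}
    (hf : ∀ x y, G.Adj x y → |f y - f x| ≤ 1) (hg : ∀ y, G.laplacian g y = c - f y) (x : V) :
    K ^ 2 * G.gammaOp 1 g g x ≤ G.maxDegree / 2 := by
  have : Nonempty V := hG.nonempty
  obtain ⟨m, hm⟩ := Finite.exists_max (G.gammaOp 1 g g)
  have h1 : G.laplacian (G.gammaOp 1 g g) m ≤ 0 :=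
    Finset.sum_nonpos fun y _ => by linarith [hm y]
  have h2 := gammaOp_one_sub_smul_le hK (hcurv m) (hf m) hg
  have h3 := G.gammaOp_one_self_nonneg (f - K • g) m
  have h4 := mul_le_mul_of_nonneg_left (hm x) (sq_nonneg K)
  nlinarith

theorem Connected.sub_le_of_laplacian_eq (hG : G.Connected) {K : ℝ} (hK : 0 < K)
    (hcurv : ∀ x, (K : EReal) ≤ G.bakryEmeryCurvature x) {f g : V → ℝ} {c : ℝ}
    (hf : ∀ x y, G.Adj x y → |f y - f x| ≤ 1) (hg : ∀ y, G.laplacian g y = c - f y) (x : V) :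
    c - f x ≤ G.maxDegree / K := by
  rw [← hg x]
  refine le_of_sq_le_sq ?_ (by positivity)
  have h1 := laplacian_sq_le (G := G) g x
  have h2 := hG.sq_mul_gammaOp_one_le hK hcurv hf hg x
  rw [div_pow, le_div_iff₀ (by positivity)]
  calc G.laplacian g x ^ 2 * K ^ 2 ≤ 2 * G.maxDegree * G.gammaOp 1 g g x * K ^ 2 := by gcongr
    _ = 2 * G.maxDegree * (K ^ 2 * G.gammaOp 1 g g x) := by ring
    _ ≤ 2 * G.maxDegree * (G.maxDegree / 2) := by gcongr
    _ = (G.maxDegree : ℝ) ^ 2 := by ring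

/-- Rigidity of the mean estimate: in the equality case `f` is, up to a constant, an eigenfunction
and has maximal gradient everywhere. -/
theorem Connected.rigidity_of_sub_eq (hG : G.Connected) {K : ℝ} (hK : 0 < K)
    (hcurv : ∀ x, (K : EReal) ≤ G.bakryEmeryCurvature x) {f g : V → ℝ} {c : ℝ}
    (hf : ∀ x y, G.Adj x y → |f y - f x| ≤ 1) (hg : ∀ y, G.laplacian g y = c - f y) {x₀ : V}
    (h₀ : c - f x₀ = G.maxDegree / K) :
    (∀ x, G.laplacian f x = K * (c - f x)) ∧ ∀ x, G.gammaOp 1 f f x = G.maxDegree / 2 := by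
  have hle : ∀ x, G.gammaOp 1 g g x ≤ G.maxDegree / 2 / K ^ 2 := fun x => by
    rw [le_div_iff₀' (by positivity)]
    exact hG.sq_mul_gammaOp_one_le hK hcurv hf hg x
  have hx₀ : G.gammaOp 1 g g x₀ = G.maxDegree / 2 / K ^ 2 := by
    refine le_antisymm (hle x₀) ?_
    -- Equality in Cauchy–Schwarz is divided by 2D, so D = 0 is separate.
    rcases (Nat.cast_nonneg (α := ℝ) G.maxDegree).eq_or_lt with hD | hD
    · rw [← hD]
      simpa using G.gammaOp_one_self_nonneg g x₀
    · have h1 := laplacian_sq_le (G := G) g x₀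
      rw [hg, h₀, div_pow] at h1
      have h2 : (G.maxDegree : ℝ) ^ 2 / K ^ 2 =
          2 * G.maxDegree * (G.maxDegree / 2 / K ^ 2) := by ring
      rw [h2] at h1
      exact le_of_mul_le_mul_left h1 (by positivity)
  have hconst : ∀ x, G.gammaOp 1 g g x = G.maxDegree / 2 / K ^ 2 := by
    refine hG.eq_of_laplacian_nonneg hle hx₀ fun x hx => ?_
    have h1 := gammaOp_one_sub_smul_le hK (hcurv x) (hf x) hg
    rw [hx, mul_div_cancel₀ _ (by positivity)] at h1
    have h2 := G.gammaOp_one_self_nonneg (f - K • g) x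
    exact nonneg_of_mul_nonneg_right (by linarith) hK
  have hdiff : ∀ x y, G.Adj x y → f y - f x = K * (g y - g x) := by
    intro x y hxy
    have h1 := gammaOp_one_sub_smul_le hK (hcurv x) (hf x) hg
    have h2 : G.laplacian (G.gammaOp 1 g g) x = 0 := by simp [laplacian, hconst]
    rw [hconst, h2, mul_div_cancel₀ _ (by positivity), sub_self, mul_zero, add_zero] at h1
    have h3 := G.eq_of_gammaOp_one_self_nonpos h1 hxy
    simp only [Pi.sub_apply, Pi.smul_apply, smul_eq_mul] at h3
    linarith
  constructor
  · intro x
    rw [← hg, laplacian, laplacian, Finset.mul_sum]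
    exact Finset.sum_congr rfl fun y hy => hdiff x y (by simpa using hy)
  · intro x
    have h1 : G.gammaOp 1 f f x = K ^ 2 * G.gammaOp 1 g g x := by
      rw [gammaOp_one_apply, gammaOp_one_apply, mul_div_assoc', Finset.mul_sum]
      congr 1
      refine Finset.sum_congr rfl fun y hy => ?_
      rw [hdiff x y (by simpa using hy)]
      ring
    rw [h1, hconst, mul_div_cancel₀ _ (by positivity)]

/-- If the effective diameter is maximal then all distance functions are extremal. -/
theorem Connected.dist_rigidity (hG : G.Connected) {K : ℝ} (hK : 0 < K)
    (hcurv : ∀ x, (K : EReal) ≤ G.bakryEmeryCurvature x)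
    (hdiam : G.effectiveDiam = (G.maxDegree : ℝ) / K) (x : V) :
    (∀ y, G.laplacian (fun z => (G.dist x z : ℝ)) y = G.maxDegree - K * G.dist x y) ∧
      ∀ y, G.gammaOp 1 (fun z => (G.dist x z : ℝ)) (fun z => (G.dist x z : ℝ)) y =
        G.maxDegree / 2 := by
  have : Nonempty V := hG.nonempty
  have hcard : (0 : ℝ) < Fintype.card V := Nat.cast_pos.mpr Fintype.card_pos
  set c : V → ℝ := fun x => (∑ y, (G.dist x y : ℝ)) / Fintype.card V with hc
  have hex : ∀ x, ∃ g, G.laplacian g = fun y => c x - G.dist x y := fun x => by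
    refine hG.exists_laplacian_eq ?_
    simp only [Finset.sum_sub_distrib, Finset.sum_const, Finset.card_univ, nsmul_eq_mul, hc]
    rw [mul_div_cancel₀ _ hcard.ne', sub_self]
  choose g hg using hex
  have hg' : ∀ x y, G.laplacian (g x) y = c x - G.dist x y := fun x y => by rw [hg x]
  have hlip : ∀ x y z, G.Adj y z → |(G.dist x z : ℝ) - G.dist x y| ≤ 1 :=
    fun x y z => hG.abs_dist_sub_dist_le_one x
  have hle : ∀ x, c x ≤ G.maxDegree / K := fun x => by
    simpa using hG.sub_le_of_laplacian_eq hK hcurv (hlip x) (hg' x) x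
  have hsum : ∑ x, c x = ∑ _x : V, (G.maxDegree : ℝ) / K := by
    rw [← hdiam, Finset.sum_const, Finset.card_univ, nsmul_eq_mul, effectiveDiam, hc,
      ← Finset.sum_div]
    field_simp
  have heq : c x = G.maxDegree / K :=
    (Finset.sum_eq_sum_iff_of_le fun x _ => hle x).mp hsum x (Finset.mem_univ x)
  obtain ⟨h1, h2⟩ := hG.rigidity_of_sub_eq hK hcurv (hlip x) (hg' x) (x₀ := x) (by simpa using heq)
  refine ⟨fun y => ?_, h2⟩
  rw [h1, heq, mul_sub, mul_div_cancel₀ _ hK.ne']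

/-- An eigenfunction for the smallest eigenvalue allowed by the curvature bound is determined by
its values on any ball of radius one. -/
theorem Connected.eq_zero_of_laplacian_eq_neg_mul (hG : G.Connected) {K : ℝ}
    (hcurv : ∀ x, (K : EReal) ≤ G.bakryEmeryCurvature x) {h : V → ℝ}
    (hh : ∀ x, G.laplacian h x = -K * h x) {o : V} (ho : h o = 0)
    (hn : ∀ v, G.Adj o v → h v = 0) (x : V) : h x = 0 := by
  have : Nonempty V := hG.nonempty
  have hsub : ∀ x, 0 ≤ G.laplacian (G.gammaOp 1 h h) x := by
    intro x
    have h1 := G.mul_gammaOp_one_le_gammaOp_two (hcurv x) h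
    have h2 : G.laplacian h = (-K) • h := funext hh
    have h3 := congrFun (G.gammaOp_smul 1 1 (-K) h h) x
    rw [one_smul, one_mul, Pi.smul_apply, smul_eq_mul] at h3
    rw [gammaOp_two_self, h2, h3] at h1
    linarith
  obtain ⟨m, hm⟩ := Finite.exists_max (G.gammaOp 1 h h)
  have hconst := hG.eq_of_laplacian_nonneg hm rfl fun x _ => hsub x
  have ho' : G.gammaOp 1 h h o = 0 := by
    rw [gammaOp_one_apply, Finset.sum_eq_zero, zero_div]
    intro y hy
    rw [ho, hn y (by simpa using hy)]
    ring
  rw [← ho]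
  refine hG.eq_of_forall_adj (fun x y hxy => G.eq_of_gammaOp_one_self_nonpos ?_ hxy) x o
  rw [hconst x, ← hconst o, ho']

end Operators

/-! ### Recognising the hypercube -/

theorem hypercube_adj_iff {n : ℕ} {a b : Fin n → Bool} :
    (hypercube n).Adj a b ↔ ∃ i, b = Function.update a i (!a i) := by
  change #{i | a i ≠ b i} = 1 ↔ _
  rw [Finset.card_eq_one]
  refine exists_congr fun i => ?_
  constructor
  · intro h
    ext j
    have := Finset.ext_iff.mp h j
    simp only [Finset.mem_filter, Finset.mem_univ, true_and, Finset.mem_singleton] at this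
    by_cases hj : j = i
    · subst hj
      simp only [Function.update_self]
      revert this
      cases a j <;> cases b j <;> simp
    · simp only [Function.update_of_ne hj]
      exact (not_not.mp (mt this.mp hj)).symm
  · rintro rfl
    ext j
    by_cases hj : j = i
    · subst hj
      simp
    · simp [hj]

/-- An injective homomorphism from a nonempty `n`-regular graph to the `n`-cube is an
isomorphism. -/
theorem nonempty_iso_hypercube_of_injective {V : Type*} [Fintype V] [Nonempty V]
    {G : SimpleGraph V} [DecidableRel G.Adj] {n : ℕ} (hreg : G.IsRegularOfDegree n)
    (φ : V → Fin n → Bool) (hinj : Function.Injective φ)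
    (hadj : ∀ x y, G.Adj x y → (hypercube n).Adj (φ x) (φ y)) :
    Nonempty (G ≃g hypercube n) := by
  have hflip : ∀ x i, ∃ y, G.Adj x y ∧ φ y = Function.update (φ x) i (!φ x i) := by
    intro x i
    have hsub : (G.neighborFinset x).image φ ⊆
        univ.image fun i => Function.update (φ x) i (!φ x i) := by
      intro b hb
      obtain ⟨y, hy, rfl⟩ := Finset.mem_image.mp hb
      obtain ⟨j, hj⟩ := hypercube_adj_iff.mp (hadj x y (by simpa using hy))
      exact Finset.mem_image.mpr ⟨j, Finset.mem_univ j, hj.symm⟩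
    have heq := Finset.eq_of_subset_of_card_le hsub (by
      rw [Finset.card_image_of_injective _ hinj, card_neighborFinset_eq_degree, hreg x]
      exact Finset.card_image_le.trans (by simp))
    have hi : Function.update (φ x) i (!φ x i) ∈ (G.neighborFinset x).image φ :=
      heq ▸ Finset.mem_image_of_mem _ (Finset.mem_univ i)
    obtain ⟨y, hy, hy'⟩ := Finset.mem_image.mp hi
    exact ⟨y, by simpa using hy, hy'⟩
  have hsurj : Function.Surjective φ := by
    obtain ⟨o⟩ := ‹Nonempty V›
    -- Any b is reached from φ o by correcting one coordinate at a time.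
    have key : ∀ (b : Fin n → Bool) (s : Finset (Fin n)),
        ∃ y, φ y = fun i => if i ∈ s then b i else φ o i := by
      intro b s
      induction s using Finset.induction_on with
      | empty => exact ⟨o, by simp⟩
      | insert a s ha ih =>
        obtain ⟨y, hy⟩ := ih
        by_cases hab : φ y a = b a
        · refine ⟨y, funext fun i => ?_⟩
          by_cases hi : i = a
          · subst hi
            simp [hab]
          · simp [hy, hi]
        · obtain ⟨z, -, hz⟩ := hflip y a
          refine ⟨z, funext fun i => ?_⟩
          rw [hz]
          by_cases hi : i = a
          · subst hi
            simpa using Bool.not_eq.mpr hab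
          · simp [hy, hi]
    intro b
    obtain ⟨y, hy⟩ := key b univ
    exact ⟨y, by simpa using hy⟩
  refine ⟨⟨Equiv.ofBijective φ ⟨hinj, hsurj⟩, fun {x y} => ⟨fun h => ?_, hadj x y⟩⟩⟩
  obtain ⟨i, hi⟩ := hypercube_adj_iff.mp h
  obtain ⟨z, hz, hz'⟩ := hflip x i
  rwa [hinj (hi.trans hz'.symm)]

end SimpleGraph

open SimpleGraph Finset

theorem mainTheorem12 {V : Type*} [Fintype V] (G : SimpleGraph V) [DecidableRel G.Adj]
    (hG : G.Connected) (K : ℝ) (hK : 0 < K)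
    (hcurv : ∀ x : V, (K : EReal) ≤ G.bakryEmeryCurvature x)
    (hdiam : G.effectiveDiam = (G.maxDegree : ℝ) / K) :
    ∃ n : ℕ, Nonempty (G ≃g SimpleGraph.hypercube n) := by
  have : Nonempty V := hG.nonempty
  have hlap := fun x => (hG.dist_rigidity hK hcurv hdiam x).1
  have hgam := fun x => (hG.dist_rigidity hK hcurv hdiam x).2
  have hsq : ∀ x y z, G.Adj y z → ((G.dist x z : ℝ) - G.dist x y) ^ 2 ≤ 1 := fun x y z h => by
    rw [sq_le_one_iff_abs_le_one]
    exact hG.abs_dist_sub_dist_le_one x h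
  have hsum : ∀ x y, ∑ z ∈ G.neighborFinset y, ((G.dist x z : ℝ) - G.dist x y) ^ 2 =
      G.maxDegree := fun x y => by
    have := hgam x y
    rw [gammaOp_one_apply, div_left_inj' two_ne_zero] at this
    rw [← this]
    exact Finset.sum_congr rfl fun z _ => sq _
  have hreg : G.IsRegularOfDegree G.maxDegree := fun y => by
    refine le_antisymm (G.degree_le_maxDegree y) ?_
    have : (G.maxDegree : ℝ) ≤ G.degree y := by
      rw [← hsum y y]
      refine (Finset.sum_le_card_nsmul _ _ 1 fun z hz => hsq y y z (by simpa using hz)).trans ?_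
      rw [card_neighborFinset_eq_degree, nsmul_one]
    exact_mod_cast this
  have hone : ∀ x y z, G.Adj y z → ((G.dist x z : ℝ) - G.dist x y) ^ 2 = 1 := by
    intro x y z hyz
    -- D terms, each at most 1, with sum D.
    refine (Finset.sum_eq_sum_iff_of_le (s := G.neighborFinset y) (g := fun _ => (1 : ℝ))
      fun z hz => hsq x y z (by simpa using hz)).mp ?_ z (by simpa using hyz)
    rw [hsum, Finset.sum_const, card_neighborFinset_eq_degree, hreg y, nsmul_one]
  have hstep : ∀ x y z, G.Adj y z →
      G.dist x z = G.dist x y + 1 ∨ G.dist x y = G.dist x z + 1 := by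
    intro x y z hyz
    rcases sq_eq_one_iff.mp (hone x y z hyz) with h | h
    · left
      have : (G.dist x z : ℝ) = G.dist x y + 1 := by linarith
      exact_mod_cast this
    · right
      have : (G.dist x y : ℝ) = G.dist x z + 1 := by linarith
      exact_mod_cast this
  obtain ⟨o⟩ := hG.nonempty
  have hcard : Fintype.card (Fin G.maxDegree) = Fintype.card (G.neighborFinset o) := by
    rw [Fintype.card_fin, Fintype.card_coe, card_neighborFinset_eq_degree, hreg o]
  let e : Fin G.maxDegree ≃ G.neighborFinset o := Fintype.equivOfCardEq hcard
  have he : ∀ i, G.Adj o (e i) := fun i => (G.mem_neighborFinset o _).mp (e i).2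
  let φ : V → Fin G.maxDegree → Bool := fun y i => decide (G.dist y (e i) < G.dist y o)
  have hφ : ∀ y i, φ y i = true ↔ G.dist y (e i) < G.dist y o := fun y i => decide_eq_true_iff
  have hcount : ∀ y, (#{i | φ y i = true} : ℝ) = K / 2 * G.dist y o := by
    intro y
    have h1 := hlap y o
    rw [laplacian, ← Finset.sum_coe_sort, ← Equiv.sum_comp e] at h1
    have h2 : ∀ i, (G.dist y (e i) : ℝ) - G.dist y o = 1 - 2 * if φ y i = true then 1 else 0 := by
      intro i
      simp only [hφ]
      rcases hstep y o (e i) (he i) with h | h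
      · rw [if_neg (by omega), h]
        push_cast
        ring
      · rw [if_pos (by omega), h]
        push_cast
        ring
    simp only [h2, Finset.sum_sub_distrib, ← Finset.mul_sum, Finset.sum_boole,
      Finset.sum_const, Finset.card_univ, Fintype.card_fin, nsmul_one] at h1
    linarith
  -- An edge is needed: for a single vertex K is arbitrary. The only neighbour of o closer to `e j`
  -- than o is `e j` itself.
  have hK2 : ∀ _ : Fin G.maxDegree, K = 2 := by
    intro j
    have h1 := hcount (e j)
    have hd : G.dist (e j) o = 1 := dist_eq_one_iff_adj.mpr (he j).symm
    have h2 : ({i | φ (e j) i = true} : Finset (Fin G.maxDegree)) = {j} := by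
      ext i
      simp only [Finset.mem_filter, Finset.mem_univ, true_and, Finset.mem_singleton, hφ, hd,
        Nat.lt_one_iff, hG.dist_eq_zero_iff, Subtype.coe_inj, e.injective.eq_iff]
      exact eq_comm
    rw [h2, hd, Finset.card_singleton] at h1
    push_cast at h1
    linarith
  have hhom : ∀ y z, G.Adj y z → G.dist o z = G.dist o y + 1 →
      (hypercube G.maxDegree).Adj (φ y) (φ z) := by
    intro y z hyz hd
    rw [SimpleGraph.dist_comm, SimpleGraph.dist_comm (u := o)] at hd
    have hmono : ∀ i, φ y i = true → φ z i = true := by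
      intro i
      rw [hφ, hφ, hd]
      intro h
      have := hG.dist_triangle (u := z) (v := y) (w := e i)
      rw [dist_eq_one_iff_adj.mpr hyz.symm] at this
      omega
    have hpos : 0 < G.maxDegree := by
      rw [← hreg y, ← card_neighborFinset_eq_degree]
      exact Finset.card_pos.mpr ⟨z, by simpa using hyz⟩
    have hK' := hK2 ⟨0, hpos⟩
    have hy := hcount y
    have hz := hcount z
    rw [hK', div_self two_ne_zero, one_mul, Nat.cast_inj] at hy hz
    have hsub : ({i | φ y i = true} : Finset (Fin G.maxDegree)) ⊆
        ({i | φ z i = true} : Finset (Fin G.maxDegree)) :=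
      Finset.monotone_filter_right _ fun i _ => hmono i
    have hdiff := Finset.card_sdiff_of_subset hsub
    change #{i | φ y i ≠ φ z i} = 1
    have heq : ({i | φ y i ≠ φ z i} : Finset (Fin G.maxDegree)) =
        ({i | φ z i = true} : Finset (Fin G.maxDegree)) \
          ({i | φ y i = true} : Finset (Fin G.maxDegree)) := by
      ext i
      simp only [Finset.mem_filter, Finset.mem_univ, true_and, Finset.mem_sdiff]
      have := hmono i
      revert this
      cases φ y i <;> cases φ z i <;> simp
    rw [heq]
    omega
  refine ⟨G.maxDegree, nonempty_iso_hypercube_of_injective hreg φ ?_ ?_⟩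
  · intro y z hyz
    have ho : G.dist y o = G.dist z o := by
      have h1 := hcount y
      rw [hyz, hcount z] at h1
      exact_mod_cast (mul_left_cancel₀ (half_pos hK).ne' h1).symm
    -- Each distance differs from that to o by ±1, and φ records the sign.
    have hn : ∀ v, G.Adj o v → G.dist y v = G.dist z v := by
      intro v hv
      obtain ⟨i, hi⟩ := e.surjective ⟨v, by simpa using hv⟩
      have hy := hφ y i
      rw [hyz, hφ z i, hi] at hy
      have h1 := hstep y o v hv
      have h2 := hstep z o v hv
      simp only at hy
      omega
    have h := hG.eq_zero_of_laplacian_eq_neg_mul hcurv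
      (h := fun x => (G.dist y x : ℝ) - G.dist z x) (o := o) (fun x => ?_) (by simp [ho])
      (fun v hv => by simp [hn v hv]) y
    · simp only [SimpleGraph.dist_self, Nat.cast_zero, zero_sub, neg_eq_zero, Nat.cast_eq_zero] at h
      exact (hG.dist_eq_zero_iff.mp h).symm
    · have h1 := hlap y x
      have h2 := hlap z x
      simp only [laplacian] at h1 h2 ⊢
      simp only [sub_sub_sub_comm (_ : ℝ) _ _ _, Finset.sum_sub_distrib] at h1 h2 ⊢
      linarith
  · intro y z hyz
    rcases hstep o y z hyz with h | h
    · exact hhom y z hyz h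
    · exact (hhom z y hyz.symm h).symm
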